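/- **Setting.** Let $\mathcal X$ be a locally compact separable metric space with its Borel $\sigma$-algebra and let $X=(X_t)_{t\ge 0}$ be an $\mathcal X$-valued strong Markov process with càdlàg paths on a filtered space $(\Omega,\mathcal F,(\mathcal F_t)_{t\ge0})$, with laws $(\mathbb P_x)_{x\in\mathcal X}$, $\mathbb P_x(X_0=x)=1$. Assume that $X$ is positive Harris recurrent with invariant probability measure $\pi$ and ergodic, i.e. $\lim_{t\to\infty}\|\mathbb P_x(X_t\in\cdot)-\pi\|_{\mathrm{TV}}=0$ for all $x$. **Condition $\mathbf L(V,\varphi,\Psi)$.** $V:\mathcal X\to[1,\infty)$ is continuous, $\limsup_{t\to\infty}V(X_t)=\infty$ $\mathbb P_x$-a.s. for every $x$, and there is $\ell_0\in[1,\infty)$ such that: (i) $\varphi:(0,1]\to[0,\infty)$ is non-decreasing and continuous, $r\mapsto r\varphi(1/r)$ is (strictly) decreasing on $[1,\infty)$ with limit $0$ at infinity, and for some $b\ge0$ and every $x\in\mathcal X$ the process $$\frac1{V(X_t)}-\int_0^t\varphi\Big(\frac1{V(X_u)}\Big)\,du-b\int_0^t\mathbf 1\{V(X_u)\le\ell_0\}\,du,\qquad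 t\ge0,$$ is an $(\mathcal F_t)$-supermartingale under $\mathbb P_x$; (ii) $\Psi:[1,\infty)\to[1,\infty)$ is differentiable, (strictly) increasing and submultiplicative (there is a constant $K$ with $\Psi(r_1+r_2)\le K\Psi(r_1)\Psi(r_2)$ for all $r_1,r_2\geq 1$), and for every $\ell>\ell_0$ there is $C_\ell>0$ such that $$\mathbb P_x\big(T^{(r)}<S_{(\ell)}\big)\ge C_\ell/\Psi(r)\qquad\text{for all } r>\ell+1\text{ and all } x\text{ with }V(x)\ge\ell+1,$$ where $T^{(r)}=\inf\{t\ge0:V(X_t)>r\}$ and $S_{(\ell)}=\inf\{t\ge0:V(X_t)<\ell\}$ (with $\inf\emptyset=\infty$). **Theorem.** Assume $\mathbf L(V,\varphi,\Psi)$. Let $D\subset\mathcal X$ be a Borel set with $D\subset\{V\le m\}$ for some $m\in(1,\infty)$, let $q\in(0,1)$ and $\varepsilon=(1-q)/2$, and for $\delta>0$ put $\tau_D(\delta)=\inf\{t>\delta:X_t\in D\}$. (a) Let $h:[1,\infty)\to[1,\infty)$ be non-decreasing and continuous. Then $v\mapsto \varepsilon h(v)/(v\varphi(1/v))$ is continuous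 and strictly increasing on $[1,\infty)$ and maps $[1,\infty)$ bijectively onto $[\varepsilon h(1)/\varphi(1),\infty)$; let $G_h$ denote its inverse. For every $x\in\mathcal X$ there exist constants $C,r_0,\delta\in(0,\infty)$ such that $$\mathbb P_x\Big(\int_0^{\tau_D(\delta)}h(V(X_s))\,ds\ge r\Big)\ge\frac{C}{\Psi(2G_h(r)/(1-q))}\qquad\text{for all } r>r_0 .$$ (b) Let $G_1$ be the inverse obtained for $h\equiv1$. For every $x\in\mathcal X$ there exist constants $C,t_0,\delta\in(0,\infty)$ such that $$\mathbb P_x(\tau_D(\delta)\ge t)\ge\frac{C}{\Psi(2G_1(t)/(1-q))}\qquad\text{for all } t>t_0 .$$ -/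

import Mathlib

open Set Filter Topology MeasureTheory ProbabilityTheory
open scoped NNReal ENNReal

namespace LDrift

/-- Every path `t ↦ X t ω` is right-continuous and has left limits. -/
def IsCadlag {E Ω : Type*} [TopologicalSpace E] (X : ℝ≥0 → Ω → E) : Prop :=
  ∀ ω t, ContinuousWithinAt (fun s => X s ω) (Ici t) t ∧
    ∃ y, Tendsto (fun s => X s ω) (𝓝[<] t) (𝓝 y)

/-- `X` is a càdlàg strong Markov process on the filtered space `(Ω, F)`, with `P x` the law under
which `X` starts from `x`.  In the strong Markov property, `B` is an arbitrary measurable set of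
paths (for the product σ-algebra), `T` an arbitrary stopping time, which may take the value `⊤`,
and `A` an arbitrary event of the σ-algebra at time `T`:
`P_x(A, T < ∞, X_{T + ·} ∈ B) = E_x[1_{A, T < ∞} P_{X_T}(X ∈ B)]`. -/
structure IsStrongMarkov {E Ω : Type*} [TopologicalSpace E] [MeasurableSpace E]
    [mΩ : MeasurableSpace Ω] (F : Filtration ℝ≥0 mΩ) (X : ℝ≥0 → Ω → E) (P : E → Measure Ω) :
    Prop where
  isProbabilityMeasure : ∀ x, IsProbabilityMeasure (P x)
  adapted : Adapted F X
  cadlag : IsCadlag X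
  start : ∀ x, ∀ᵐ ω ∂(P x), X 0 ω = x
  measurable_law : ∀ B : Set (ℝ≥0 → E), MeasurableSet B →
    Measurable fun x => P x {ω | (fun t => X t ω) ∈ B}
  strong_markov : ∀ (x : E) (T : Ω → WithTop ℝ≥0) (hT : IsStoppingTime F T) (A : Set Ω),
    MeasurableSet[hT.measurableSpace] A → ∀ B : Set (ℝ≥0 → E), MeasurableSet B →
    P x (A ∩ {ω | T ω ≠ ⊤ ∧ (fun t => X ((T ω).untopD 0 + t) ω) ∈ B}) =
      ∫⁻ ω in A ∩ {ω | T ω ≠ ⊤},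
        P (X ((T ω).untopD 0) ω) {ω' | (fun t => X t ω') ∈ B} ∂(P x)

/-- `π` is invariant: `∫ E_x[g(X_t)] π(dx) = ∫ g dπ` for bounded measurable `g ≥ 0`. -/
def IsInvariant {E Ω : Type*} [MeasurableSpace E] [MeasurableSpace Ω]
    (X : ℝ≥0 → Ω → E) (P : E → Measure Ω) (π : Measure E) : Prop :=
  ∀ (g : E → ℝ≥0), Measurable g → (∃ K : ℝ≥0, ∀ x, g x ≤ K) → ∀ t : ℝ≥0,
    ∫⁻ x, ∫⁻ ω, (g (X t ω) : ℝ≥0∞) ∂(P x) ∂π = ∫⁻ x, (g x : ℝ≥0∞) ∂π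

/-- Harris recurrence: for some nonzero σ-finite `ν`, the process spends, almost surely from every
starting point, an infinite amount of time in every set of positive `ν`-measure. -/
def IsHarrisRecurrent {E Ω : Type*} [MeasurableSpace E] [MeasurableSpace Ω]
    (X : ℝ≥0 → Ω → E) (P : E → Measure Ω) : Prop :=
  ∃ ν : Measure E, SigmaFinite ν ∧ ν ≠ 0 ∧ ∀ A, MeasurableSet A → 0 < ν A → ∀ x,
    ∀ᵐ ω ∂(P x), ∫⁻ s in Ioi (0 : ℝ), A.indicator (fun _ => (1 : ℝ≥0∞)) (X s.toNNReal ω) = ⊤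

/-- The total variation `sup {|∫ g dμ - ∫ g dν| : g measurable, |g| ≤ 1}` of `μ - ν`
(meant for probability measures). -/
noncomputable def tvNorm {E : Type*} [MeasurableSpace E] (μ ν : Measure E) : ℝ :=
  ⨆ g : {g : E → ℝ // Measurable g ∧ ∀ x, |g x| ≤ 1}, |∫ x, g.1 x ∂μ - ∫ x, g.1 x ∂ν|

/-- `X` is positive Harris recurrent and ergodic, with invariant probability measure `π`. -/
structure IsErgodicHarris {E Ω : Type*} [MeasurableSpace E] [MeasurableSpace Ω]
    (X : ℝ≥0 → Ω → E) (P : E → Measure Ω) (π : Measure E) : Prop where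
  isProbabilityMeasure : IsProbabilityMeasure π
  invariant : IsInvariant X P π
  harris : IsHarrisRecurrent X P
  ergodic : ∀ x, Tendsto (fun t => tvNorm ((P x).map (X t)) π) atTop (𝓝 0)

/-- `inf {t ≥ 0 : X_t ∈ A}`, with value `⊤` if the set is empty. -/
noncomputable def entryTime {E Ω : Type*} (X : ℝ≥0 → Ω → E) (A : Set E) (ω : Ω) : ℝ≥0∞ :=
  sInf ((fun t : ℝ≥0 => (t : ℝ≥0∞)) '' {t | X t ω ∈ A})

/-- `τ_D(δ) = inf {t > δ : X_t ∈ D}`, with value `⊤` if the set is empty. -/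
noncomputable def hitAfter {E Ω : Type*} (X : ℝ≥0 → Ω → E) (D : Set E) (δ : ℝ≥0) (ω : Ω) :
    ℝ≥0∞ :=
  sInf ((fun t : ℝ≥0 => (t : ℝ≥0∞)) '' {t | δ < t ∧ X t ω ∈ D})

/-- `∫_0^τ f(X_s) ds ∈ [0, ∞]` along the path `ω`, for `f ≥ 0` and `τ ∈ [0, ∞]`. -/
noncomputable def additiveFunctional {E Ω : Type*} (X : ℝ≥0 → Ω → E) (f : E → ℝ) (τ : ℝ≥0∞)
    (ω : Ω) : ℝ≥0∞ :=
  ∫⁻ s in {s : ℝ | 0 < s ∧ ENNReal.ofReal s < τ}, ENNReal.ofReal (f (X s.toNNReal ω))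

/-- Condition (i) at level `ℓ₀`.  Functions on `(0, 1]` are functions on `ℝ` of which only the
values on `(0, 1]` matter. -/
structure DriftCondition {E Ω : Type*} [mΩ : MeasurableSpace Ω] (F : Filtration ℝ≥0 mΩ)
    (X : ℝ≥0 → Ω → E) (P : E → Measure Ω) (V : E → ℝ) (φ : ℝ → ℝ) (ℓ₀ : ℝ) : Prop where
  nonneg : ∀ u ∈ Ioc (0 : ℝ) 1, 0 ≤ φ u
  monotone : MonotoneOn φ (Ioc 0 1)
  continuous : ContinuousOn φ (Ioc 0 1)
  strictAnti : StrictAntiOn (fun r => r * φ (1 / r)) (Ici 1)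
  tendsto_zero : Tendsto (fun r => r * φ (1 / r)) atTop (𝓝 0)
  supermartingale : ∃ b : ℝ, 0 ≤ b ∧ ∀ x, Supermartingale
    (fun (t : ℝ≥0) ω => 1 / V (X t ω) - (∫ u in (0 : ℝ)..t, φ (1 / V (X u.toNNReal ω)))
      - b * ∫ u in (0 : ℝ)..t, {y | V y ≤ ℓ₀}.indicator (fun _ => (1 : ℝ)) (X u.toNNReal ω))
    F (P x)

/-- Condition (ii) at level `ℓ₀`.  Functions on `[1, ∞)` are functions on `ℝ` of which only the
values on `[1, ∞)` matter. -/
structure ExitCondition {E Ω : Type*} [MeasurableSpace Ω]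
    (X : ℝ≥0 → Ω → E) (P : E → Measure Ω) (V : E → ℝ) (Ψ : ℝ → ℝ) (ℓ₀ : ℝ) : Prop where
  one_le : ∀ r, 1 ≤ r → 1 ≤ Ψ r
  differentiable : DifferentiableOn ℝ Ψ (Ici 1)
  strictMono : StrictMonoOn Ψ (Ici 1)
  submultiplicative : ∃ K : ℝ, 0 < K ∧ ∀ r₁ r₂, 1 ≤ r₁ → 1 ≤ r₂ →
    Ψ (r₁ + r₂) ≤ K * Ψ r₁ * Ψ r₂
  exit : ∀ ℓ, ℓ₀ < ℓ → ∃ K : ℝ, 0 < K ∧ ∀ r, ℓ + 1 < r → ∀ x, ℓ + 1 ≤ V x →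
    K / Ψ r ≤ (P x).real {ω | entryTime X {y | r < V y} ω < entryTime X {y | V y < ℓ} ω}

/-- The **L**-drift condition `L(V, φ, Ψ)`. -/
structure LCondition {E Ω : Type*} [TopologicalSpace E] [mΩ : MeasurableSpace Ω]
    (F : Filtration ℝ≥0 mΩ) (X : ℝ≥0 → Ω → E) (P : E → Measure Ω)
    (V : E → ℝ) (φ Ψ : ℝ → ℝ) : Prop where
  continuous : Continuous V
  one_le : ∀ x, 1 ≤ V x
  nonconfinement : ∀ x, ∀ᵐ ω ∂(P x), limsup (fun t => (V (X t ω) : EReal)) atTop = ⊤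
  drift : ∃ ℓ₀ : ℝ, 1 ≤ ℓ₀ ∧ DriftCondition F X P V φ ℓ₀ ∧ ExitCondition X P V Ψ ℓ₀

/-- The function `v ↦ ε h(v) / (v φ(1/v))`. -/
noncomputable def growth (φ : ℝ → ℝ) (ε : ℝ) (h : ℝ → ℝ) (v : ℝ) : ℝ :=
  ε * h v / (v * φ (1 / v))

/-- `G_h`, the inverse of `v ↦ ε h(v) / (v φ(1/v))` on `[1, ∞)`. -/
noncomputable def growthInv (φ : ℝ → ℝ) (ε : ℝ) (h : ℝ → ℝ) : ℝ → ℝ :=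
  Function.invFunOn (growth φ ε h) (Ici 1)

end LDrift

/-! Given `r`, put `v = G_h(r)` and `t = ε / (v φ(1/v))`, so that `h(v) t = r`: it suffices that `V`
spends a time `t` above `v` before the return to `D`. Three events produce this. By nonconfinement,
`V(X_δ) ≥ ℓ + 1` has positive probability for some `δ`, where `ℓ` exceeds `ℓ₀` and `m`
(`IsStrongMarkov.exists_pos_measure_le`). From there `V` passes `R = 2v/(1-q)` before going below
`ℓ` with probability at least `K / Ψ(R)`, by the exit condition. From above `R`, it stays above `v`
for a time `t` with probability at least `q` (`le_measure_stayOn`). The Markov property multiplies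
the three bounds; since `ℓ, v > m`, the set `D` is avoided throughout.

The third bound is optional stopping for the drift supermartingale at the descent below `v`: until
then the compensator grows at rate at most `φ(1/v)`, while at the descent `1/V` is at least `1/v`,
so the probability of descent is at most `v (1/V(z) + t φ(1/v))` (`measureReal_exists_lt_le`).

Events and hitting times are read off dyadic grids, and right-continuity recovers continuous time.
Thus the Markov property is needed only at fixed times and optional stopping only in discrete time.
-/

namespace LDrift

/-! ### Dyadic grids -/

/-- The `k`-th point `t * k / 2 ^ n` of the dyadic grid of order `n` scaled by `t`. -/
noncomputable def gridPt (t : ℝ≥0) (n k : ℕ) : ℝ≥0 := t * k / 2 ^ n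

theorem gridPt_mono (t : ℝ≥0) (n : ℕ) : Monotone (gridPt t n) := fun i j hij => by
  unfold gridPt; gcongr

theorem gridPt_zero (t : ℝ≥0) (n : ℕ) : gridPt t n 0 = 0 := by simp [gridPt]

/-- Scaling makes `t` itself a point of every grid. The index is not bounded by `2 ^ n`: with scale
`1` the grids exhaust the dyadic times of `[0, ∞)`. -/
theorem gridPt_two_pow (t : ℝ≥0) (n : ℕ) : gridPt t n (2 ^ n) = t := by
  simp [gridPt]

theorem gridPt_succ (t : ℝ≥0) (n k : ℕ) : gridPt t (n + 1) (2 * k) = gridPt t n k := by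
  unfold gridPt
  rw [pow_succ, div_eq_div_iff (by positivity) (by positivity)]
  push_cast; ring

theorem exists_gridPt_mem {t : ℝ≥0} (ht : 0 < t) {a b : ℝ≥0} (hab : a < b) :
    ∃ n k, a < gridPt t n k ∧ gridPt t n k < b := by
  have ht' : (0 : ℝ) < t := ht
  have hab' : (0 : ℝ) < b - a := sub_pos.2 (by exact_mod_cast hab)
  obtain ⟨n, hn⟩ := pow_unbounded_of_one_lt ((t : ℝ) / (b - a)) (one_lt_two)
  rw [div_lt_iff₀ hab'] at hn
  have h2 : (0 : ℝ) < 2 ^ n := by positivity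
  -- The mesh `t / 2 ^ n` is less than `b - a`; the witness is the first grid point strictly after
  -- `a`.
  refine ⟨n, ⌊(a : ℝ) * 2 ^ n / t⌋₊ + 1, ?_, ?_⟩
  · have h := Nat.lt_floor_add_one ((a : ℝ) * 2 ^ n / t)
    rw [div_lt_iff₀ ht'] at h
    rw [← NNReal.coe_lt_coe]
    simp only [gridPt]
    push_cast
    rw [lt_div_iff₀ h2]
    linarith
  · have h := Nat.floor_le (a := (a : ℝ) * 2 ^ n / t) (by positivity)
    rw [le_div_iff₀ ht'] at h
    rw [← NNReal.coe_lt_coe]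
    simp only [gridPt]
    push_cast
    rw [div_lt_iff₀ h2]
    linarith

theorem exists_gridPt_of_rightContinuous {t : ℝ≥0} (ht : 0 < t) {g : ℝ≥0 → ℝ} {a b : ℝ≥0}
    (hg : ContinuousWithinAt g (Ici a) a) {S : Set ℝ} (hS : S ∈ 𝓝 (g a)) (hab : a < b) :
    ∃ n k, a < gridPt t n k ∧ gridPt t n k < b ∧ g (gridPt t n k) ∈ S := by
  obtain ⟨c, hc, hcS⟩ := (mem_nhdsGE_iff_exists_Ico_subset' hab).1 (hg hS)
  obtain ⟨n, k, h1, h2⟩ := exists_gridPt_mem ht (lt_min (mem_Ioi.1 hc) hab)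
  exact ⟨n, k, h1, h2.trans_le (min_le_right _ _),
    hcS ⟨h1.le, h2.trans_le (min_le_left _ _)⟩⟩

/-! ### Path events determined by dyadic times -/

section Paths

variable {E : Type*}

/-- Paths along which `V ≥ c` at all dyadic times in `I`. -/
def stayOn (V : E → ℝ) (c : ℝ) (I : Set ℝ≥0) : Set (ℝ≥0 → E) :=
  {w | ∀ n k, gridPt 1 n k ∈ I → c ≤ V (w (gridPt 1 n k))}

/-- Paths along which `V` exceeds `R` for the first time on the `n`-th dyadic grid at its `k`-th
point, while `V ≥ ℓ` at all dyadic times before. -/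
def reachAt (V : E → ℝ) (R ℓ : ℝ) (n k : ℕ) : Set (ℝ≥0 → E) :=
  {w | R < V (w (gridPt 1 n k)) ∧ (∀ j < k, V (w (gridPt 1 n j)) ≤ R) ∧
    w ∈ stayOn V ℓ (Iic (gridPt 1 n k))}

/-- Paths that exceed `R` on a dyadic grid before going below `ℓ`, and then stay above `v` for a
time `t`. -/
def reachStay (V : E → ℝ) (R ℓ v : ℝ) (t : ℝ≥0) : Set (ℝ≥0 → E) :=
  {w | ∃ n k, w ∈ reachAt V R ℓ n k ∧ (fun u => w (gridPt 1 n k + u)) ∈ stayOn V v (Iio t)}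

theorem le_of_mem_stayOn {V : E → ℝ} {c : ℝ} {I : Set ℝ≥0} {w : ℝ≥0 → E}
    (hw : ∀ u, ContinuousWithinAt (fun s => V (w s)) (Ici u) u) (h : w ∈ stayOn V c I)
    {u t : ℝ≥0} (hut : u < t) (hI : Iio t ⊆ I) : c ≤ V (w u) := by
  by_contra! hlt
  obtain ⟨n, k, -, h2, h3⟩ := exists_gridPt_of_rightContinuous one_pos (hw u)
    (Iio_mem_nhds hlt) hut
  exact (h n k (hI h2)).not_gt h3

/-- The σ-algebra `m` is left free so that the same proof serves on path space, on `Ω`, and for the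
past `F (gridPt 1 n k)`. -/
theorem measurableSet_stayOn [MeasurableSpace E] {Ω : Type*} {m : MeasurableSpace Ω}
    {Y : ℝ≥0 → Ω → E} {I : Set ℝ≥0} (hY : ∀ u ∈ I, Measurable (Y u)) {V : E → ℝ}
    (hV : Measurable V) (c : ℝ) : MeasurableSet {ω | (fun t => Y t ω) ∈ stayOn V c I} := by
  have : {ω | (fun t => Y t ω) ∈ stayOn V c I} =
      ⋂ n, ⋂ k, ⋂ (_ : gridPt 1 n k ∈ I), {ω | c ≤ V (Y (gridPt 1 n k) ω)} := by
    ext; simp [stayOn]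
  rw [this]
  exact .iInter fun n => .iInter fun k => .iInter fun h =>
    measurableSet_le measurable_const (hV.comp (hY _ h))

theorem measurableSet_reachAt [MeasurableSpace E] {Ω : Type*} {m : MeasurableSpace Ω}
    {Y : ℝ≥0 → Ω → E} {n k : ℕ} (hY : ∀ u ≤ gridPt 1 n k, Measurable (Y u)) {V : E → ℝ}
    (hV : Measurable V) (R ℓ : ℝ) :
    MeasurableSet {ω | (fun t => Y t ω) ∈ reachAt V R ℓ n k} := by
  have : {ω | (fun t => Y t ω) ∈ reachAt V R ℓ n k} =
      {ω | R < V (Y (gridPt 1 n k) ω)} ∩ ((⋂ j, ⋂ (_ : j < k), {ω | V (Y (gridPt 1 n j) ω) ≤ R}) ∩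
        {ω | (fun t => Y t ω) ∈ stayOn V ℓ (Iic (gridPt 1 n k))}) := by
    ext; simp [reachAt]
  rw [this]
  refine (measurableSet_lt measurable_const (hV.comp (hY _ le_rfl))).inter
    (.inter (.iInter fun j => .iInter fun hj => ?_) (measurableSet_stayOn hY hV ℓ))
  exact measurableSet_le (hV.comp (hY _ (gridPt_mono 1 n hj.le))) measurable_const

theorem measurableSet_stayOn_path [MeasurableSpace E] {V : E → ℝ} (hV : Measurable V) (c : ℝ)
    (I : Set ℝ≥0) : MeasurableSet (stayOn V c I) :=
  measurableSet_stayOn (Y := fun t (w : ℝ≥0 → E) => w t) (fun u _ => measurable_pi_apply u) hV c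

theorem measurableSet_reachStay [MeasurableSpace E] {V : E → ℝ} (hV : Measurable V) (R ℓ v : ℝ)
    (t : ℝ≥0) : MeasurableSet (reachStay V R ℓ v t) := by
  have : reachStay V R ℓ v t = ⋃ n, ⋃ k, (reachAt V R ℓ n k ∩
      (fun w u => w (gridPt 1 n k + u)) ⁻¹' stayOn V v (Iio t)) := by
    ext; simp [reachStay]
  rw [this]
  refine .iUnion fun n => .iUnion fun k => .inter ?_ ?_
  · exact measurableSet_reachAt (Y := fun t (w : ℝ≥0 → E) => w t)
      (fun u _ => measurable_pi_apply u) hV R ℓ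
  · exact measurable_pi_lambda _ (fun u => measurable_pi_apply _)
      (measurableSet_stayOn_path hV v _)

/-- Paths that, at some point of the `n`-th dyadic grid, exceed `R` not having gone below `ℓ`. -/
def reachGrid (V : E → ℝ) (R ℓ : ℝ) (n : ℕ) : Set (ℝ≥0 → E) :=
  {w | ∃ k, R < V (w (gridPt 1 n k)) ∧ w ∈ stayOn V ℓ (Iic (gridPt 1 n k))}

theorem reachGrid_eq_iUnion (V : E → ℝ) (R ℓ : ℝ) (n : ℕ) :
    reachGrid V R ℓ n = ⋃ k, reachAt V R ℓ n k := by
  classical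
  ext w
  simp only [mem_iUnion]
  constructor
  · rintro ⟨k, h1, h2⟩
    have hex : ∃ k, R < V (w (gridPt 1 n k)) := ⟨k, h1⟩
    refine ⟨Nat.find hex, Nat.find_spec hex, fun j hj => not_lt.1 (Nat.find_min hex hj), ?_⟩
    exact fun m i hi => h2 m i (le_trans hi (gridPt_mono 1 n (Nat.find_min' hex h1)))
  · rintro ⟨k, h1, -, h2⟩
    exact ⟨k, h1, h2⟩

theorem monotone_reachGrid (V : E → ℝ) (R ℓ : ℝ) : Monotone (reachGrid V R ℓ) := by
  refine monotone_nat_of_le_succ fun n => ?_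
  rintro w ⟨k, h1, h2⟩
  exact ⟨2 * k, by rwa [gridPt_succ], by rwa [gridPt_succ]⟩

/-- The two entry times leave a gap; by right-continuity, a dyadic time in that gap still sees `V`
above `R`. -/
theorem exists_mem_reachGrid {Ω : Type*} {X : ℝ≥0 → Ω → E} {ω : Ω} {V : E → ℝ}
    (hw : ∀ u, ContinuousWithinAt (fun s => V (X s ω)) (Ici u) u) {R ℓ : ℝ}
    (h : entryTime X {y | R < V y} ω < entryTime X {y | V y < ℓ} ω) :
    ∃ n, (fun t => X t ω) ∈ reachGrid V R ℓ n := by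
  obtain ⟨_, ⟨t, ht, rfl⟩, hlt⟩ := sInf_lt_iff.1 h
  obtain ⟨s, hs1, hs2⟩ := ENNReal.lt_iff_exists_nnreal_btwn.1 hlt
  obtain ⟨n, k, h1, h2, h3⟩ := exists_gridPt_of_rightContinuous one_pos (hw t)
    (Ioi_mem_nhds ht) (ENNReal.coe_lt_coe.1 hs1)
  refine ⟨n, k, h3, fun m i hi => ?_⟩
  by_contra! hlow
  have : entryTime X {y | V y < ℓ} ω ≤ (gridPt 1 m i : ℝ≥0∞) := sInf_le ⟨_, hlow, rfl⟩
  have h4 : ((gridPt 1 m i : ℝ≥0) : ℝ≥0∞) < s := by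
    exact_mod_cast lt_of_le_of_lt hi h2
  exact (hs2.trans_le this).not_gt h4

end Paths

/-! ### Consequences of the Markov property -/

section Markov

variable {E Ω : Type*} [TopologicalSpace E] [MeasurableSpace E] [mΩ : MeasurableSpace Ω] {F : Filtration ℝ≥0 mΩ} {X : ℝ≥0 → Ω → E} {P : E → Measure Ω}

theorem IsStrongMarkov.measurable (hX : IsStrongMarkov F X P) (t : ℝ≥0) : Measurable (X t) :=
  (hX.adapted t).mono (F.le t) le_rfl

theorem IsStrongMarkov.markov (hX : IsStrongMarkov F X P) (x : E) (s : ℝ≥0) {A : Set Ω}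
    (hA : MeasurableSet[F s] A) {B : Set (ℝ≥0 → E)} (hB : MeasurableSet B) :
    P x (A ∩ {ω | (fun t => X (s + t) ω) ∈ B}) =
      ∫⁻ ω in A, P (X s ω) {ω' | (fun t => X t ω') ∈ B} ∂(P x) := by
  have h := hX.strong_markov x (fun _ => (s : WithTop ℝ≥0)) (isStoppingTime_const F s) A
    (by rwa [IsStoppingTime.measurableSpace_const]) B hB
  have hs : (WithTop.some s : WithTop ℝ≥0) ≠ ⊤ := WithTop.coe_ne_top
  have hs' : (WithTop.some s : WithTop ℝ≥0).untopD 0 = s := WithTop.untopD_coe 0 s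
  simpa only [hs, hs', ne_eq, not_false_eq_true, true_and, ofPred_true, inter_univ] using h

/-- A lower bound on the conditional probability of a future event passes to the joint event. -/
theorem IsStrongMarkov.mul_le_measure_inter (hX : IsStrongMarkov F X P) (x : E) (s : ℝ≥0)
    {A : Set Ω} (hA : MeasurableSet[F s] A) {B : Set (ℝ≥0 → E)} (hB : MeasurableSet B) {c : ℝ≥0∞}
    (hc : ∀ ω ∈ A, c ≤ P (X s ω) {ω' | (fun t => X t ω') ∈ B}) :
    c * P x A ≤ P x (A ∩ {ω | (fun t => X (s + t) ω) ∈ B}) := by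
  rw [hX.markov x s hA hB, ← setLIntegral_const]
  exact setLIntegral_mono' (F.le s _ hA) hc

theorem IsStrongMarkov.rightContinuous (hX : IsStrongMarkov F X P) {V : E → ℝ} (hV : Continuous V)
    (ω : Ω) (u : ℝ≥0) : ContinuousWithinAt (fun s => V (X s ω)) (Ici u) u :=
  hV.continuousAt.comp_continuousWithinAt (hX.cadlag ω u).1

variable [BorelSpace E]

/-- For fixed `n`, the event is split according to the first grid point above `R`, and the Markov
property is applied at each such deterministic time. -/
theorem IsStrongMarkov.mul_measure_reachGrid_le (hX : IsStrongMarkov F X P) {V : E → ℝ}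
    (hV : Continuous V) (y : E) {R ℓ v : ℝ} {t : ℝ≥0} {c : ℝ≥0∞}
    (hc : ∀ z, R < V z → c ≤ P z {ω | (fun t => X t ω) ∈ stayOn V v (Iio t)}) (n : ℕ) :
    c * P y {ω | (fun t => X t ω) ∈ reachGrid V R ℓ n} ≤
      P y {ω | (fun t => X t ω) ∈ reachStay V R ℓ v t} := by
  have hVm : Measurable V := hV.measurable
  set A : ℕ → Set Ω := fun k => {ω | (fun t => X t ω) ∈ reachAt V R ℓ n k} with hA
  have hAm : ∀ k, MeasurableSet[F (gridPt 1 n k)] (A k) := fun k =>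
    measurableSet_reachAt (m := F (gridPt 1 n k))
      (fun u hu => (hX.adapted u).mono (F.mono hu) le_rfl) hVm R ℓ
  set B : ℕ → Set Ω := fun k =>
    {ω | (fun u => X (gridPt 1 n k + u) ω) ∈ stayOn V v (Iio t)} with hB
  have hBm : ∀ k, MeasurableSet (B k) := fun k =>
    measurableSet_stayOn (fun u _ => hX.measurable _) hVm v
  -- Disjointness is why `reachAt` asks for the first exceedance.
  have hdisj : Pairwise (Function.onFun Disjoint fun k => A k ∩ B k) := by
    have key : ∀ i j, i < j → Disjoint (A i ∩ B i) (A j ∩ B j) := fun i j hij =>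
      Set.disjoint_left.2 fun ω hi hj => (hj.1.2.1 i hij).not_gt hi.1.1
    intro i j hij
    rcases lt_or_gt_of_ne hij with h | h
    exacts [key i j h, (key j i h).symm]
  have hU : {ω | (fun t => X t ω) ∈ reachGrid V R ℓ n} = ⋃ k, A k := by
    ext ω; simp [reachGrid_eq_iUnion, hA]
  calc c * P y {ω | (fun t => X t ω) ∈ reachGrid V R ℓ n}
      ≤ c * ∑' k, P y (A k) := by rw [hU]; gcongr; exact measure_iUnion_le _
    _ = ∑' k, c * P y (A k) := ENNReal.tsum_mul_left.symm
    _ ≤ ∑' k, P y (A k ∩ B k) := ENNReal.tsum_le_tsum fun k =>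
        hX.mul_le_measure_inter y _ (hAm k) (measurableSet_stayOn_path hVm v _) <| by
          intro ω hω
          exact hc _ hω.1
    _ = P y (⋃ k, A k ∩ B k) :=
        (measure_iUnion hdisj fun k => (F.le _ _ (hAm k)).inter (hBm k)).symm
    _ ≤ _ := measure_mono <| by
        intro ω hω
        obtain ⟨k, hk⟩ := mem_iUnion.1 hω
        exact ⟨n, k, hk.1, hk.2⟩

/-- The upper bound for one grid does not depend on `n`, and the grid events increase to one that
contains the exit event. -/
theorem IsStrongMarkov.mul_measure_entryTime_lt_le (hX : IsStrongMarkov F X P) {V : E → ℝ}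
    (hV : Continuous V) (y : E) {R ℓ v : ℝ} {t : ℝ≥0} {c : ℝ≥0∞}
    (hc : ∀ z, R < V z → c ≤ P z {ω | (fun t => X t ω) ∈ stayOn V v (Iio t)}) :
    c * P y {ω | entryTime X {y | R < V y} ω < entryTime X {y | V y < ℓ} ω} ≤
      P y {ω | (fun t => X t ω) ∈ reachStay V R ℓ v t} := by
  have hmono : Monotone fun n => {ω | (fun t => X t ω) ∈ reachGrid V R ℓ n} := by
    intro i j hij ω hω
    change (fun t => X t ω) ∈ reachGrid V R ℓ i at hω
    change (fun t => X t ω) ∈ reachGrid V R ℓ j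
    exact monotone_reachGrid V R ℓ hij hω
  calc _ ≤ c * P y (⋃ n, {ω | (fun t => X t ω) ∈ reachGrid V R ℓ n}) := by
        gcongr
        exact fun ω hω => mem_iUnion.2 (exists_mem_reachGrid (hX.rightContinuous hV ω) hω)
    _ = ⨆ n, c * P y {ω | (fun t => X t ω) ∈ reachGrid V R ℓ n} := by
        rw [hmono.measure_iUnion, ENNReal.mul_iSup]
    _ ≤ _ := iSup_le fun n => hX.mul_measure_reachGrid_le hV y hc n

omit [BorelSpace E] in
/-- Nonconfinement puts the process above any level at some positive time with positive
probability. -/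
theorem IsStrongMarkov.exists_pos_measure_le (hX : IsStrongMarkov F X P) {V : E → ℝ}
    (hV : Continuous V) {x : E}
    (hlim : ∀ᵐ ω ∂(P x), limsup (fun t => (V (X t ω) : EReal)) atTop = ⊤) (L : ℝ) :
    ∃ δ : ℝ≥0, 0 < δ ∧ 0 < P x {ω | L ≤ V (X δ ω)} := by
  by_contra! hcon
  have := hX.isProbabilityMeasure x
  -- There are countably many dyadic times, so the exceptional null sets can be united.
  have hall : ∀ᵐ ω ∂(P x), ∀ n k, 0 < gridPt 1 n k → V (X (gridPt 1 n k) ω) < L := by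
    refine ae_all_iff.2 fun n => ae_all_iff.2 fun k => ?_
    by_cases h : 0 < gridPt 1 n k
    · have h0 := nonpos_iff_eq_zero.1 (hcon _ h)
      rw [ae_iff]
      simpa [h] using h0
    · simp [h]
  obtain ⟨ω, h1, h2⟩ := (hall.and hlim).exists
  have hfreq : ∃ᶠ t in atTop, (L : EReal) < V (X t ω) :=
    frequently_lt_of_lt_limsup (by isBoundedDefault) (by rw [h2]; exact EReal.coe_lt_top L)
  obtain ⟨t, ht⟩ := hfreq.exists
  obtain ⟨n, k, h3, -, h4⟩ := exists_gridPt_of_rightContinuous one_pos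
    (hX.rightContinuous hV ω t) (Ioi_mem_nhds (EReal.coe_lt_coe_iff.1 ht)) (lt_add_one t)
  exact (h1 n k (pos_of_gt h3)).not_gt h4

end Markov

end LDrift

/-! ### Hitting times along grids and an integral bound -/

namespace LDrift

/-- The integral over `(0, s]` of a function with values in `[0, K]`, and at most `c` before `a`. -/
theorem intervalIntegral_le_of_le_before {f : ℝ → ℝ} {c K a s t : ℝ} (hc : 0 ≤ c) (hK : 0 ≤ K)
    (has : a ≤ s) (hs : 0 ≤ s) (hst : s ≤ t) (h0 : ∀ u, 0 < u → 0 ≤ f u)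
    (hfc : ∀ u, 0 < u → u < a → f u ≤ c) (hfK : ∀ u, 0 < u → f u ≤ K) :
    ∫ u in (0 : ℝ)..s, f u ≤ t * c + K * (s - a) := by
  have hi1 : IntegrableOn (fun _ : ℝ => c) (Ioc 0 s) := integrableOn_const (by simp)
  have hi2 : IntegrableOn ((Ici a).indicator fun _ : ℝ => K) (Ioc 0 s) :=
    (integrableOn_const (C := K) (by simp)).indicator measurableSet_Ici
  rw [intervalIntegral.integral_of_le hs]
  calc ∫ u in Ioc 0 s, f u
      ≤ ∫ u in Ioc 0 s, (c + (Ici a).indicator (fun _ : ℝ => K) u) := by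
        -- Only the majorant has to be integrable, so nothing about the measurability of `f` is
        -- required.
        refine integral_mono_of_nonneg ?_ (hi1.add hi2) ?_
        · filter_upwards [ae_restrict_mem measurableSet_Ioc] with u hu using h0 u hu.1
        · filter_upwards [ae_restrict_mem measurableSet_Ioc] with u hu
          by_cases hua : u < a
          · simpa [hua] using hfc u hu.1 hua
          · have := hfK u hu.1
            simp only [mem_Ici, not_lt.1 hua, indicator_of_mem]
            linarith
    _ = s * c + volume.real (Ici a ∩ Ioc 0 s) * K := by
        rw [integral_add hi1 hi2, integral_indicator measurableSet_Ici,
          Measure.restrict_restrict measurableSet_Ici]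
        simp [hs]
    _ ≤ t * c + (s - a) * K := by
        gcongr
        calc volume.real (Ici a ∩ Ioc 0 s) ≤ volume.real (Icc a s) :=
              measureReal_mono (fun u hu => ⟨hu.1, hu.2.2⟩) (by simp)
          _ = s - a := by simp [has]
    _ = _ := by ring

section GridHitting

variable {E Ω : Type*}

/-- Hitting time of `{V < v}` along the dyadic grid of order `n` of `[0, t]`, as an index. -/
noncomputable def gridIndex (X : ℝ≥0 → Ω → E) (V : E → ℝ) (v : ℝ) (t : ℝ≥0) (n : ℕ) (ω : Ω) : ℕ :=
  hittingBtwn (fun k ω => X (gridPt t n k) ω) {y | V y < v} 0 (2 ^ n) ω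

/-- Hitting time of `{V < v}` along the dyadic grid of order `n` of `[0, t]`. -/
noncomputable def gridHit (X : ℝ≥0 → Ω → E) (V : E → ℝ) (v : ℝ) (t : ℝ≥0) (n : ℕ) (ω : Ω) : ℝ≥0 :=
  gridPt t n (gridIndex X V v t n ω)

variable {X : ℝ≥0 → Ω → E} {V : E → ℝ} {v : ℝ} {t : ℝ≥0}

theorem gridIndex_le (n : ℕ) (ω : Ω) : gridIndex X V v t n ω ≤ 2 ^ n := hittingBtwn_le ω

theorem gridHit_le (n : ℕ) (ω : Ω) : gridHit X V v t n ω ≤ t := by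
  simpa [gridHit, gridPt_two_pow] using gridPt_mono t n (gridIndex_le (X := X) (V := V) n ω)

theorem gridHit_le_of_lt {n k : ℕ} {ω : Ω} (hk : k ≤ 2 ^ n) (h : V (X (gridPt t n k) ω) < v) :
    gridHit X V v t n ω ≤ gridPt t n k :=
  gridPt_mono t n (hittingBtwn_le_of_mem (Nat.zero_le k) hk h)

theorem gridHit_antitone (ω : Ω) : Antitone fun n => gridHit X V v t n ω := by
  refine antitone_nat_of_succ_le fun n => ?_
  rcases (gridIndex_le (X := X) (V := V) (v := v) (t := t) n ω).lt_or_eq with h | h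
  · have hmem : V (X (gridPt t n (gridIndex X V v t n ω)) ω) < v :=
      hittingBtwn_mem_set_of_hittingBtwn_lt h
    rw [← gridPt_succ] at hmem
    have := gridHit_le_of_lt (n := n + 1) (by rw [pow_succ]; lia) hmem
    rwa [gridPt_succ] at this
  -- Index `2 ^ n` means a hit at the last point or the default value in the absence of a hit;
  -- either way the time is `t`.
  · have : gridHit X V v t n ω = t := by simp [gridHit, h, gridPt_two_pow]
    rw [this]
    exact gridHit_le _ ω

/-- Paths below `v` somewhere on the dyadic grid of order `n` of `[0, t]`. -/
def lowGrid (X : ℝ≥0 → Ω → E) (V : E → ℝ) (v : ℝ) (t : ℝ≥0) (n : ℕ) : Set Ω :=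
  {ω | ∃ k ≤ 2 ^ n, V (X (gridPt t n k) ω) < v}

theorem lowGrid_mono : Monotone (lowGrid X V v t) := by
  refine monotone_nat_of_le_succ fun n => ?_
  rintro ω ⟨k, hk, h⟩
  exact ⟨2 * k, by rw [pow_succ]; lia, by rwa [gridPt_succ]⟩

theorem lt_of_mem_lowGrid {n : ℕ} {ω : Ω} (h : ω ∈ lowGrid X V v t n) :
    V (X (gridHit X V v t n ω) ω) < v := by
  obtain ⟨k, hk, h⟩ := h
  exact hittingBtwn_mem_set (u := fun k ω => X (gridPt t n k) ω) (s := {y | V y < v})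
    ⟨k, ⟨Nat.zero_le k, hk⟩, h⟩

/-- A value below `v` would persist at some grid point just to the right, still before the infimum,
contradicting the hitting time of that grid. -/
theorem le_of_lt_iInf_gridHit {ω : Ω} (ht : 0 < t)
    (hw : ∀ u, ContinuousWithinAt (fun s => V (X s ω)) (Ici u) u) {u : ℝ≥0}
    (hu : (u : ℝ) < ⨅ n, (gridHit X V v t n ω : ℝ)) : v ≤ V (X u ω) := by
  by_contra! hlt
  have hbdd : BddBelow (range fun n => (gridHit X V v t n ω : ℝ)) :=
    ⟨0, by rintro _ ⟨n, rfl⟩; exact NNReal.coe_nonneg _⟩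
  have hcoe : ((⨅ n, gridHit X V v t n ω : ℝ≥0) : ℝ) = ⨅ n, (gridHit X V v t n ω : ℝ) :=
    NNReal.coe_iInf _
  rw [← hcoe, NNReal.coe_lt_coe] at hu
  obtain ⟨n, k, -, h2, h3⟩ := exists_gridPt_of_rightContinuous ht (hw u) (Iio_mem_nhds hlt) hu
  have h4 : (⨅ n, gridHit X V v t n ω) ≤ gridHit X V v t n ω := ciInf_le (OrderBot.bddBelow _) n
  have hk : k ≤ 2 ^ n := by
    by_contra! hk
    have h5 := gridPt_mono t n hk.le
    rw [gridPt_two_pow] at h5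
    exact (h5.trans_lt (h2.trans_le (h4.trans (gridHit_le n ω)))).false
  exact (h2.trans_le (h4.trans (gridHit_le_of_lt hk h3))).false

end GridHitting

/-! ### Slow descent from high levels -/

section Drift

variable {E Ω : Type*} [TopologicalSpace E] [MeasurableSpace E] [BorelSpace E]
  [mΩ : MeasurableSpace Ω] {F : Filtration ℝ≥0 mΩ} {X : ℝ≥0 → Ω → E} {P : E → Measure Ω}
  {V : E → ℝ} {φ : ℝ → ℝ} {ℓ₀ : ℝ}

/-- The restriction of a filtration to the dyadic grid of order `n` of `[0, t]`. -/
noncomputable def gridFiltration (F : Filtration ℝ≥0 mΩ) (t : ℝ≥0) (n : ℕ) : Filtration ℕ mΩ where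
  seq k := F (gridPt t n k)
  mono' _ _ h := F.mono (gridPt_mono t n h)
  le' _ := F.le _

theorem isStoppingTime_gridIndex (hX : IsStrongMarkov F X P) (hV : Continuous V) (v : ℝ)
    (t : ℝ≥0) (n : ℕ) : IsStoppingTime (gridFiltration F t n)
      fun ω => ((gridIndex X V v t n ω : ℕ) : WithTop ℕ) :=
  Adapted.isStoppingTime_hittingBtwn (f := gridFiltration F t n)
    (fun k => hX.adapted (gridPt t n k)) (measurableSet_lt hV.measurable measurable_const)

theorem measurable_gridHit (hX : IsStrongMarkov F X P) (hV : Continuous V) (v : ℝ)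
    (t : ℝ≥0) (n : ℕ) : Measurable (gridHit X V v t n) := by
  have h : Measurable (gridIndex X V v t n) := measurable_of_Iic fun i => by
    have := (gridFiltration F t n).le _ _ (isStoppingTime_gridIndex hX hV v t n i)
    simpa [preimage] using this
  exact (measurable_from_nat (f := gridPt t n)).comp h

theorem measurableSet_lowGrid (hX : IsStrongMarkov F X P) (hV : Continuous V) (v : ℝ)
    (t : ℝ≥0) (n : ℕ) : MeasurableSet (lowGrid X V v t n) := by
  have : lowGrid X V v t n = ⋃ k, ⋃ (_ : k ≤ 2 ^ n), {ω | V (X (gridPt t n k) ω) < v} := by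
    ext; simp [lowGrid]
  rw [this]
  exact .iUnion fun k => .iUnion fun _ =>
    measurableSet_lt (hV.measurable.comp (hX.measurable _)) measurable_const

/-- Optional stopping of a supermartingale at the hitting time of `{V < v}` along a grid. -/
theorem integral_gridHit_le (hX : IsStrongMarkov F X P) (hV : Continuous V) {μ : Measure Ω}
    [IsFiniteMeasure μ] {M : ℝ≥0 → Ω → ℝ} (hM : Supermartingale M F μ) (v : ℝ) (t : ℝ≥0) (n : ℕ) :
    Integrable (fun ω => M (gridHit X V v t n ω) ω) μ ∧
      ∫ ω, M (gridHit X V v t n ω) ω ∂μ ≤ ∫ ω, M 0 ω ∂μ := by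
  -- Optional stopping is applied to the submartingale `-M` on the grid.
  have hsub : Submartingale (fun k ω => -M (gridPt t n k) ω) (gridFiltration F t n) μ :=
    Supermartingale.neg (f := fun k => M (gridPt t n k))
      ⟨fun k => hM.1 _, fun i j hij => hM.2.1 _ _ (gridPt_mono t n hij), fun k => hM.2.2 _⟩
  have hst := isStoppingTime_gridIndex hX hV v t n
  have hb : ∀ ω, ((gridIndex X V v t n ω : ℕ) : WithTop ℕ) ≤ ((2 ^ n : ℕ) : WithTop ℕ) := fun ω =>
    WithTop.coe_le_coe.2 (gridIndex_le n ω)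
  have hval : stoppedValue (fun k ω => -M (gridPt t n k) ω)
      (fun ω => ((gridIndex X V v t n ω : ℕ) : WithTop ℕ)) =
        fun ω => -M (gridHit X V v t n ω) ω := rfl
  have hint := hsub.integrable_stoppedValue hst hb
  have hle := hsub.expected_stoppedValue_mono (isStoppingTime_const _ 0) hst
    (fun ω => WithTop.coe_le_coe.2 (Nat.zero_le _)) hb
  have hval0 : stoppedValue (fun k ω => -M (gridPt t n k) ω)
      (fun _ => ((0 : ℕ) : WithTop ℕ)) = fun ω => -M 0 ω := by
    rw [← gridPt_zero t n]; rfl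
  rw [hval] at hint hle
  erw [hval0] at hle
  rw [integral_neg, integral_neg] at hle
  exact ⟨by simpa using hint.neg, by linarith⟩

/-- Descent from a high level below `v` is slow. -/
theorem measureReal_exists_lt_le (hX : IsStrongMarkov F X P) (hV : Continuous V)
    (hV1 : ∀ x, 1 ≤ V x) (hφ : DriftCondition F X P V φ ℓ₀) {v : ℝ} (hv1 : 1 ≤ v) (hv : ℓ₀ < v)
    {t : ℝ≥0} (ht : 0 < t) (z : E) :
    (P z).real {ω | ∃ u < t, V (X u ω) < v} ≤ v * (1 / V z + t * φ (1 / v)) := by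
  have := hX.isProbabilityMeasure z
  obtain ⟨b, hb, hM⟩ := hφ.supermartingale
  specialize hM z
  set M : ℝ≥0 → Ω → ℝ := fun (t : ℝ≥0) ω =>
    1 / V (X t ω) - (∫ u in (0 : ℝ)..t, φ (1 / V (X u.toNNReal ω)))
      - b * ∫ u in (0 : ℝ)..t, {y | V y ≤ ℓ₀}.indicator (fun _ => (1 : ℝ)) (X u.toNNReal ω) with hMdef
  have hv0 : 0 < v := by linarith
  have hpos : ∀ y, 0 < V y := fun y => by linarith [hV1 y]
  have hmem : ∀ r : ℝ, 1 ≤ r → 1 / r ∈ Ioc (0 : ℝ) 1 := fun r hr =>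
    ⟨by positivity, by rw [div_le_one (by linarith)]; exact hr⟩
  have hone : (1 : ℝ) ∈ Ioc (0 : ℝ) 1 := by simp
  have hφ1 : 0 ≤ φ 1 := hφ.nonneg 1 hone
  have hφv : 0 ≤ φ (1 / v) := hφ.nonneg _ (hmem v hv1)
  have hφle : ∀ {y r}, 1 ≤ r → r ≤ V y → φ (1 / V y) ≤ φ (1 / r) := fun {y r} hr hry =>
    hφ.monotone (hmem _ (hV1 y)) (hmem r hr) (one_div_le_one_div_of_le (by linarith) hry)
  set s : ℕ → Ω → ℝ≥0 := fun n ω => gridHit X V v t n ω with hs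
  set a : Ω → ℝ := fun ω => ⨅ n, (s n ω : ℝ) with ha
  have hbdd : ∀ ω, BddBelow (range fun n => (s n ω : ℝ)) := fun ω =>
    ⟨0, by rintro _ ⟨n, rfl⟩; exact NNReal.coe_nonneg _⟩
  have has : ∀ n ω, a ω ≤ s n ω := fun n ω => ciInf_le (hbdd ω) n
  have ha0 : ∀ ω, 0 ≤ a ω := fun ω => le_ciInf fun n => NNReal.coe_nonneg _
  have hst : ∀ n ω, (s n ω : ℝ) ≤ t := fun n ω => NNReal.coe_le_coe.2 (gridHit_le n ω)
  have hsm : ∀ n, Measurable fun ω => (s n ω : ℝ) := fun n =>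
    (measurable_gridHit hX hV v t n).coe_nnreal_real
  have ham : Measurable a := Measurable.iInf hsm
  have hbelow : ∀ ω (u : ℝ), 0 < u → u < a ω → v ≤ V (X u.toNNReal ω) := fun ω u hu hua =>
    le_of_lt_iInf_gridHit ht (hX.rightContinuous hV ω)
      (by rw [Real.coe_toNNReal _ hu.le]; exact hua)
  -- Before `a ω` one has `V ≥ v > ℓ₀`, so the drift is at most `φ (1 / v)` and the indicator
  -- vanishes. Between `a ω` and the grid time only the crude bounds `φ 1` and `1` are available;
  -- their cost is the gap term.
  have hpath : ∀ n ω, (lowGrid X V v t n).indicator (fun _ => 1 / v) ω - t * φ (1 / v)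
      - (φ 1 + b) * (s n ω - a ω) ≤ M (s n ω) ω := by
    intro n ω
    have h1 : ∫ u in (0 : ℝ)..(s n ω), φ (1 / V (X u.toNNReal ω)) ≤
        t * φ (1 / v) + φ 1 * (s n ω - a ω) :=
      intervalIntegral_le_of_le_before hφv hφ1 (has n ω) (NNReal.coe_nonneg _) (hst n ω)
        (fun u _ => hφ.nonneg _ (hmem _ (hV1 _))) (fun u hu hua => hφle hv1 (hbelow ω u hu hua))
        (fun u _ => by simpa using hφle le_rfl (hV1 (X u.toNNReal ω)))
    have h2 : ∫ u in (0 : ℝ)..(s n ω),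
        {y | V y ≤ ℓ₀}.indicator (fun _ => (1 : ℝ)) (X u.toNNReal ω) ≤
        t * 0 + 1 * (s n ω - a ω) := by
      refine intervalIntegral_le_of_le_before le_rfl zero_le_one (has n ω) (NNReal.coe_nonneg _)
        (hst n ω) (fun u _ => indicator_nonneg (fun _ _ => zero_le_one) _) (fun u hu hua => ?_)
        (fun u _ => indicator_le_self' (fun _ _ => zero_le_one) _)
      rw [indicator_of_notMem]
      exact not_le.2 (hv.trans_le (hbelow ω u hu hua))
    have h3 : (lowGrid X V v t n).indicator (fun _ => 1 / v) ω ≤ 1 / V (X (s n ω) ω) := by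
      by_cases h : ω ∈ lowGrid X V v t n
      · rw [indicator_of_mem h]
        exact one_div_le_one_div_of_le (hpos _) (lt_of_mem_lowGrid h).le
      · rw [indicator_of_notMem h]
        exact one_div_nonneg.2 (hpos _).le
    have h4 := mul_le_mul_of_nonneg_left h2 hb
    simp only [hMdef]
    linarith
  have hgapint : ∀ n, Integrable (fun ω => (s n ω : ℝ) - a ω) (P z) := fun n =>
    Integrable.of_bound ((hsm n).sub ham).aestronglyMeasurable t <| ae_of_all _ fun ω => by
      rw [Real.norm_eq_abs, abs_of_nonneg (sub_nonneg.2 (has n ω))]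
      linarith [ha0 ω, hst n ω]
  have hLm := measurableSet_lowGrid hX hV v t
  have hexp : ∀ n, (P z).real (lowGrid X V v t n) / v ≤
      1 / V z + t * φ (1 / v) + (φ 1 + b) * ∫ ω, ((s n ω : ℝ) - a ω) ∂(P z) := by
    intro n
    obtain ⟨hi, hle⟩ := integral_gridHit_le hX hV hM v t n
    have hM0 : ∫ ω, M 0 ω ∂(P z) = 1 / V z := by
      have : M 0 =ᵐ[P z] fun _ => 1 / V z := by
        filter_upwards [hX.start z] with ω hω
        simp [hMdef, hω]
      rw [integral_congr_ae this]; simp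
    have hi1 : Integrable ((lowGrid X V v t n).indicator fun _ : Ω => 1 / v) (P z) :=
      (integrable_const _).indicator (hLm n)
    have hi2 : Integrable (fun ω => (lowGrid X V v t n).indicator (fun _ => 1 / v) ω
        - t * φ (1 / v)) (P z) := hi1.sub (integrable_const _)
    have hmono := integral_mono (hi2.sub ((hgapint n).const_mul (φ 1 + b))) hi (hpath n)
    simp only [Pi.sub_apply] at hmono
    rw [integral_sub hi2 ((hgapint n).const_mul _), integral_sub hi1 (integrable_const _),
      integral_indicator (hLm n),
      integral_const_mul (φ 1 + b) fun ω => (s n ω : ℝ) - a ω] at hmono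
    simp only [integral_const, measureReal_restrict_apply_univ, smul_eq_mul, probReal_univ,
      one_mul] at hmono
    rw [hM0] at hle
    have : (P z).real (lowGrid X V v t n) * (1 / v) = (P z).real (lowGrid X V v t n) / v := by ring
    linarith
  -- The grid times decrease to `a`, so the gap term disappears in the limit.
  have hgap : Tendsto (fun n => ∫ ω, ((s n ω : ℝ) - a ω) ∂(P z)) atTop (𝓝 0) := by
    have h0 : ∫ _ω : Ω, (0 : ℝ) ∂(P z) = 0 := by simp
    rw [← h0]
    refine tendsto_integral_of_dominated_convergence (fun _ => (t : ℝ))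
      (fun n => (hgapint n).aestronglyMeasurable) (integrable_const _) (fun n => ae_of_all _ fun ω => ?_)
      (ae_of_all _ fun ω => ?_)
    · rw [Real.norm_eq_abs, abs_of_nonneg (sub_nonneg.2 (has n ω))]
      linarith [ha0 ω, hst n ω]
    · rw [← sub_self (a ω)]
      refine Tendsto.sub_const (tendsto_atTop_ciInf (fun i j hij => ?_) (hbdd ω)) _
      exact NNReal.coe_le_coe.2 (gridHit_antitone ω hij)
  have hmeas : Tendsto (fun n => (P z).real (lowGrid X V v t n)) atTop
      (𝓝 ((P z).real (⋃ n, lowGrid X V v t n))) :=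
    (ENNReal.tendsto_toReal (measure_ne_top _ _)).comp
      (tendsto_measure_iUnion_atTop lowGrid_mono)
  have hlim : (P z).real (⋃ n, lowGrid X V v t n) / v ≤
      1 / V z + t * φ (1 / v) + (φ 1 + b) * 0 :=
    le_of_tendsto_of_tendsto' (hmeas.div_const v) ((hgap.const_mul _).const_add _) hexp
  have hsub : {ω | ∃ u < t, V (X u ω) < v} ⊆ ⋃ n, lowGrid X V v t n := by
    rintro ω ⟨u, hut, hu⟩
    obtain ⟨n, k, -, h2, h3⟩ := exists_gridPt_of_rightContinuous ht (hX.rightContinuous hV ω u)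
      (Iio_mem_nhds hu) hut
    refine mem_iUnion.2 ⟨n, k, ?_, h3⟩
    by_contra! hk
    have h5 := gridPt_mono t n hk.le
    rw [gridPt_two_pow] at h5
    exact (h5.trans_lt h2).false
  rw [div_le_iff₀ hv0] at hlim
  calc _ ≤ (P z).real (⋃ n, lowGrid X V v t n) := measureReal_mono hsub
    _ ≤ _ := by linarith

/-- The failure probability `1 - q` is shared equally: the starting level controls `v / V z`, and
`htv` controls the drift over time `t`. -/
theorem le_measure_stayOn (hX : IsStrongMarkov F X P) (hV : Continuous V)
    (hV1 : ∀ x, 1 ≤ V x) (hφ : DriftCondition F X P V φ ℓ₀) {v : ℝ} (hv1 : 1 ≤ v) (hv : ℓ₀ < v)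
    {t : ℝ≥0} (ht : 0 < t) {q : ℝ} (hq : q < 1) (htv : v * φ (1 / v) * t ≤ (1 - q) / 2) (z : E)
    (hz : 2 * v / (1 - q) < V z) :
    ENNReal.ofReal q ≤ P z {ω | (fun t => X t ω) ∈ stayOn V v (Iio t)} := by
  have := hX.isProbabilityMeasure z
  have hmeas : MeasurableSet {ω | (fun t => X t ω) ∈ stayOn V v (Iio t)} :=
    measurableSet_stayOn (fun u _ => hX.measurable u) hV.measurable v
  have h := measureReal_exists_lt_le hX hV hV1 hφ hv1 hv ht z
  have hsub : {ω | (fun t => X t ω) ∈ stayOn V v (Iio t)}ᶜ ⊆ {ω | ∃ u < t, V (X u ω) < v} := by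
    intro ω hω
    simp only [stayOn, mem_compl_iff, mem_ofPred_eq, not_forall, not_le] at hω
    obtain ⟨n, k, h1, h2⟩ := hω
    exact ⟨_, h1, h2⟩
  have h1 : (P z).real {ω | (fun t => X t ω) ∈ stayOn V v (Iio t)}ᶜ ≤ _ :=
    (measureReal_mono hsub).trans h
  rw [probReal_compl_eq_one_sub hmeas] at h1
  have hV0 : 0 < V z := by linarith [hV1 z]
  have hvz : v * (1 / V z) ≤ (1 - q) / 2 := by
    rw [div_lt_iff₀ (by linarith)] at hz
    rw [mul_one_div, div_le_iff₀ hV0]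
    linarith
  refine ENNReal.ofReal_le_of_le_toReal ?_
  change q ≤ (P z).real _
  nlinarith

end Drift

end LDrift

/-! ### The growth function and its inverse -/

namespace LDrift

/-- The value at `v + 1` is nonnegative and the value at `v` is strictly larger. -/
theorem DriftCondition.mul_pos {E Ω : Type*} [mΩ : MeasurableSpace Ω] {F : Filtration ℝ≥0 mΩ}
    {X : ℝ≥0 → Ω → E} {P : E → Measure Ω} {V : E → ℝ} {φ : ℝ → ℝ} {ℓ₀ : ℝ}
    (hφ : DriftCondition F X P V φ ℓ₀) {v : ℝ} (hv : 1 ≤ v) : 0 < v * φ (1 / v) := by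
  have h1 : (1 : ℝ) ≤ v + 1 := by linarith
  refine lt_of_le_of_lt ?_ (hφ.strictAnti hv (mem_Ici.2 h1) (lt_add_one v))
  refine mul_nonneg (by linarith) (hφ.nonneg _ ⟨by positivity, ?_⟩)
  rwa [div_le_one (by linarith)]

section Growth

variable {E Ω : Type*} [mΩ : MeasurableSpace Ω] {F : Filtration ℝ≥0 mΩ}
  {X : ℝ≥0 → Ω → E} {P : E → Measure Ω} {V : E → ℝ} {φ : ℝ → ℝ} {ℓ₀ ε : ℝ} {h : ℝ → ℝ}

theorem strictMonoOn_growth (hφ : DriftCondition F X P V φ ℓ₀) (hε : 0 < ε)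
    (h1 : ∀ v, 1 ≤ v → 1 ≤ h v) (hm : MonotoneOn h (Ici 1)) :
    StrictMonoOn (growth φ ε h) (Ici 1) := fun a ha b hb hab =>
  div_lt_div₀' (mul_le_mul_of_nonneg_left (hm ha hb hab.le) hε.le) (hφ.strictAnti ha hb hab)
    (mul_pos hε (by linarith [h1 b hb])) (hφ.mul_pos hb)

theorem continuousOn_growth (hφ : DriftCondition F X P V φ ℓ₀) (hc : ContinuousOn h (Ici 1)) :
    ContinuousOn (growth φ ε h) (Ici 1) := by
  refine (continuousOn_const.mul hc).div (continuousOn_id.mul (hφ.continuous.comp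
    (continuousOn_const.div continuousOn_id fun v hv => ?_) fun v hv => ?_))
    fun v hv => (hφ.mul_pos hv).ne'
  · exact (zero_lt_one.trans_le (mem_Ici.1 hv)).ne'
  · have h0 := zero_lt_one.trans_le (mem_Ici.1 hv)
    exact ⟨one_div_pos.2 h0, (div_le_one h0).2 hv⟩

/-- Surjectivity comes from the intermediate value theorem: the function is unbounded since `h ≥ 1`
and the denominator tends to `0`. -/
theorem bijOn_growth (hφ : DriftCondition F X P V φ ℓ₀) (hε : 0 < ε)
    (h1 : ∀ v, 1 ≤ v → 1 ≤ h v) (hm : MonotoneOn h (Ici 1)) (hc : ContinuousOn h (Ici 1)) :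
    BijOn (growth φ ε h) (Ici 1) (Ici (growth φ ε h 1)) := by
  have hmono := strictMonoOn_growth hφ hε h1 hm
  refine ⟨fun v hv => hmono.monotoneOn self_mem_Ici hv hv, hmono.injOn, fun y hy => ?_⟩
  have hlt : 0 < ε / max y 1 := div_pos hε (lt_max_of_lt_right one_pos)
  obtain ⟨v, hv, hv1⟩ :=
    ((hφ.tendsto_zero.eventually (gt_mem_nhds hlt)).and (eventually_ge_atTop 1)).exists
  have hyv : y ≤ growth φ ε h v := by
    have h0 := hφ.mul_pos hv1
    rw [lt_div_iff₀ (lt_max_of_lt_right one_pos)] at hv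
    rw [growth, le_div_iff₀ h0]
    calc y * (v * φ (1 / v)) ≤ max y 1 * (v * φ (1 / v)) := by gcongr; exact le_max_left _ _
      _ ≤ ε := by linarith
      _ ≤ ε * h v := le_mul_of_one_le_right hε.le (h1 v hv1)
  obtain ⟨u, hu, huy⟩ := intermediate_value_Icc hv1
    ((continuousOn_growth (ε := ε) hφ hc).mono Icc_subset_Ici_self) ⟨hy, hyv⟩
  exact ⟨u, hu.1, huy⟩

end Growth

/-! ### From excursions to the additive functional -/

section Excursion

variable {E Ω : Type*} {X : ℝ≥0 → Ω → E} {V : E → ℝ}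

/-- Right-continuity upgrades the dyadic bounds to all times; `g` is the grid time of the passage
above `R`. -/
theorem exists_forall_le_of_mem_reachStay {ω : Ω}
    (hw : ∀ u, ContinuousWithinAt (fun s => V (X s ω)) (Ici u) u) {R ℓ v : ℝ} {t δ : ℝ≥0}
    (h : (fun u => X (δ + u) ω) ∈ reachStay V R ℓ v t) :
    ∃ g : ℝ≥0, (∀ u < g, ℓ ≤ V (X (δ + u) ω)) ∧ ∀ u < t, v ≤ V (X (δ + (g + u)) ω) := by
  have hshift : ∀ c u, ContinuousWithinAt (fun s => V (X (c + s) ω)) (Ici u) u := fun c u =>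
    ContinuousWithinAt.comp (f := fun s => c + s) (t := Ici (c + u)) (hw (c + u))
      (by fun_prop) fun s hs => add_le_add_right (mem_Ici.1 hs) c
  obtain ⟨n, k, h1, h2⟩ := h
  refine ⟨gridPt 1 n k, fun u hu => ?_, fun u hu => ?_⟩
  · exact le_of_mem_stayOn (w := fun u => X (δ + u) ω) (hshift δ) h1.2.2 hu Iio_subset_Iic_self
  · refine le_of_mem_stayOn (w := fun u => X (δ + (gridPt 1 n k + u)) ω) (fun u => ?_) h2 hu le_rfl
    simpa only [add_assoc] using hshift (δ + gridPt 1 n k) u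

theorem le_hitAfter {ω : Ω} {D : Set E} {m : ℝ} (hDm : D ⊆ {x | V x ≤ m}) {δ T : ℝ≥0}
    (h : ∀ u, δ < u → u < T → m < V (X u ω)) : (T : ℝ≥0∞) ≤ hitAfter X D δ ω := by
  refine le_sInf ?_
  rintro _ ⟨u, ⟨hu, huD⟩, rfl⟩
  by_contra! hlt
  exact (h u hu (ENNReal.coe_lt_coe.1 hlt)).not_ge (hDm huD)

/-- An excursion of length `t` above `v` before returning to `D` makes the additive functional at
least `t * h v`. -/
theorem le_additiveFunctional_of_mem_reachStay {ω : Ω}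
    (hw : ∀ u, ContinuousWithinAt (fun s => V (X s ω)) (Ici u) u) {D : Set E} {m : ℝ}
    (hDm : D ⊆ {x | V x ≤ m}) {R ℓ v : ℝ} (hℓ : m < ℓ) (hv : m < v) (hv1 : 1 ≤ v) {h : ℝ → ℝ}
    (hm : MonotoneOn h (Ici 1)) {t δ : ℝ≥0}
    (hp : (fun u => X (δ + u) ω) ∈ reachStay V R ℓ v t) :
    ENNReal.ofReal (h v) * t ≤ additiveFunctional X (h ∘ V) (hitAfter X D δ ω) ω := by
  obtain ⟨g, hg1, hg2⟩ := exists_forall_le_of_mem_reachStay hw hp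
  have hg3 : ∀ u, δ + g ≤ u → u < δ + g + t → v ≤ V (X u ω) := fun u hu hut => by
    obtain ⟨w, rfl⟩ := exists_add_of_le hu
    rw [add_assoc]
    exact hg2 w (lt_of_add_lt_add_left hut)
  -- Both phases, above `ℓ` and then above `v`, lie above `m`, hence outside `D`.
  have hτ : ((δ + g + t : ℝ≥0) : ℝ≥0∞) ≤ hitAfter X D δ ω := by
    refine le_hitAfter hDm fun u hu hut => ?_
    rcases lt_or_ge u (δ + g) with h | h
    · obtain ⟨w, rfl⟩ := exists_add_of_le hu.le
      exact hℓ.trans_le (hg1 w (lt_of_add_lt_add_left h))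
    · exact hv.trans_le (hg3 u h hut)
  have hsub : Ioo ((δ + g : ℝ≥0) : ℝ) (δ + g + t : ℝ≥0) ⊆
      {s : ℝ | 0 < s ∧ ENNReal.ofReal s < hitAfter X D δ ω} := fun s hs => by
    have hs0 : 0 < s := (NNReal.coe_nonneg _).trans_lt hs.1
    refine ⟨hs0, lt_of_lt_of_le ?_ hτ⟩
    rw [← ENNReal.ofReal_coe_nnreal]
    exact (ENNReal.ofReal_lt_ofReal_iff (hs0.trans hs.2)).2 hs.2
  calc ENNReal.ofReal (h v) * t
      = ∫⁻ _ in Ioo ((δ + g : ℝ≥0) : ℝ) (δ + g + t : ℝ≥0), ENNReal.ofReal (h v) := by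
        rw [setLIntegral_const, Real.volume_Ioo]
        congr 1
        push_cast
        simp
    _ ≤ ∫⁻ s in Ioo ((δ + g : ℝ≥0) : ℝ) (δ + g + t : ℝ≥0),
          ENNReal.ofReal ((h ∘ V) (X s.toNNReal ω)) := by
        refine setLIntegral_mono' measurableSet_Ioo fun s hs => ENNReal.ofReal_le_ofReal ?_
        have hvV : v ≤ V (X s.toNNReal ω) :=
          hg3 _ (NNReal.le_toNNReal_of_coe_le hs.1.le)
            ((Real.toNNReal_lt_iff_lt_coe ((NNReal.coe_nonneg _).trans hs.1.le)).2 hs.2)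
        exact hm hv1 (hv1.trans hvV) hvV
    _ ≤ _ := lintegral_mono_set hsub

/-- This reduces part (b) to part (a) with `h ≡ 1`. -/
theorem additiveFunctional_one_le (X : ℝ≥0 → Ω → E) (τ : ℝ≥0∞) (ω : Ω) :
    additiveFunctional X (fun _ => 1) τ ω ≤ τ := by
  rcases eq_or_ne τ ⊤ with rfl | hτ
  · exact le_top
  have hsub : {s : ℝ | 0 < s ∧ ENNReal.ofReal s < τ} ⊆ Ioo 0 τ.toReal := fun s hs =>
    ⟨hs.1, (ENNReal.ofReal_lt_iff_lt_toReal hs.1.le hτ).1 hs.2⟩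
  calc additiveFunctional X (fun _ => 1) τ ω
      ≤ ∫⁻ _ in Ioo 0 τ.toReal, ENNReal.ofReal 1 := lintegral_mono_set hsub
    _ = τ := by simp [hτ]

end Excursion

/-! ### Assembling the bounds -/

/-- Lower bound on the tail of the additive functional of `h` up to the return time to `D`. -/
theorem exists_le_measureReal_additiveFunctional {E Ω : Type*} [TopologicalSpace E]
    [MeasurableSpace E] [BorelSpace E] [mΩ : MeasurableSpace Ω] {F : Filtration ℝ≥0 mΩ}
    {X : ℝ≥0 → Ω → E} {P : E → Measure Ω} (hX : IsStrongMarkov F X P) {V : E → ℝ} {φ Ψ : ℝ → ℝ}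
    (hL : LCondition F X P V φ Ψ) {D : Set E} {m : ℝ} (hDm : D ⊆ {x | V x ≤ m}) {q : ℝ}
    (hq : q ∈ Ioo (0 : ℝ) 1) {h : ℝ → ℝ} (h1 : ∀ v, 1 ≤ v → 1 ≤ h v)
    (hm : MonotoneOn h (Ici 1)) (hc : ContinuousOn h (Ici 1)) (x : E) :
    ∃ (C r₀ : ℝ) (δ : ℝ≥0), 0 < C ∧ 0 < r₀ ∧ 0 < δ ∧ ∀ r, r₀ < r →
      C / Ψ (2 * growthInv φ ((1 - q) / 2) h r / (1 - q)) ≤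
        (P x).real {ω | ENNReal.ofReal r ≤
          additiveFunctional X (h ∘ V) (hitAfter X D δ ω) ω} := by
  obtain ⟨ℓ₀, hℓ₀, hφ, hΨ⟩ := hL.drift
  have hq1 : 0 < 1 - q := sub_pos.2 hq.2
  set ε := (1 - q) / 2 with hεdef
  have hε : 0 < ε := by positivity
  have := hX.isProbabilityMeasure x
  set ℓ := max ℓ₀ m + 1 with hℓ
  have hℓ₀ℓ : ℓ₀ < ℓ := by linarith [le_max_left ℓ₀ m]
  have hmℓ : m < ℓ := by linarith [le_max_right ℓ₀ m]
  have hmono := strictMonoOn_growth hφ hε h1 hm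
  have hℓ1 : ℓ + 1 ∈ Ici (1 : ℝ) := mem_Ici.2 (by linarith)
  obtain ⟨K, hK, hexit⟩ := hΨ.exit ℓ hℓ₀ℓ
  obtain ⟨δ, hδ, hpos⟩ := hX.exists_pos_measure_le hL.continuous (hL.nonconfinement x) (ℓ + 1)
  set A : Set Ω := {ω | ℓ + 1 ≤ V (X δ ω)} with hA
  have hAm : MeasurableSet[F δ] A :=
    measurableSet_le measurable_const (hL.continuous.measurable.comp (hX.adapted δ))
  have hAr : 0 < (P x).real A := ENNReal.toReal_pos hpos.ne' (measure_ne_top _ _)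
  -- The constant collects the factors of the three events that do not depend on `r`. The threshold
  -- `growth φ ε h (ℓ + 1)` forces `v > ℓ + 1`, and therefore `R > ℓ + 1`, as the exit condition
  -- demands.
  refine ⟨q * K * (P x).real A, max (growth φ ε h (ℓ + 1)) 1, δ,
    mul_pos (mul_pos hq.1 hK) hAr, lt_max_of_lt_right one_pos, hδ, fun r hr => ?_⟩
  obtain ⟨hr1, hr2⟩ := max_lt_iff.1 hr
  have hrange : r ∈ growth φ ε h '' Ici 1 := by
    rw [(bijOn_growth hφ hε h1 hm hc).image_eq]
    exact (hmono.monotoneOn self_mem_Ici hℓ1 hℓ1).trans hr1.le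
  set v := growthInv φ ε h r with hv
  have hv1 : 1 ≤ v := Function.invFunOn_mem hrange
  have hgv : growth φ ε h v = r := Function.invFunOn_eq hrange
  have hℓv : ℓ + 1 < v := (hmono.lt_iff_lt hℓ1 hv1).1 (by rwa [hgv])
  have hvφ : 0 < v * φ (1 / v) := hφ.mul_pos hv1
  -- This length gives both `v φ(1/v) t = ε`, the drift allowance, and `h(v) t = r`.
  set t : ℝ≥0 := (ε / (v * φ (1 / v))).toNNReal with ht
  have htpos : 0 < t := Real.toNNReal_pos.2 (div_pos hε hvφ)
  have htr : (t : ℝ) = ε / (v * φ (1 / v)) := Real.coe_toNNReal _ (div_pos hε hvφ).le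
  have hthr : ENNReal.ofReal (h v) * t = ENNReal.ofReal r := by
    rw [← ENNReal.ofReal_coe_nnreal, ← ENNReal.ofReal_mul (by linarith [h1 v hv1]), htr, ← hgv,
      growth]
    congr 1
    ring
  set R := 2 * v / (1 - q) with hR
  have hRv : ℓ + 1 < R := by
    rw [hR, lt_div_iff₀ hq1]
    nlinarith [hq.1]
  have hΨR : 0 < Ψ R := zero_lt_one.trans_le (hΨ.one_le R (le_trans hℓ1 hRv.le))
  have hstay : ∀ z, R < V z →
      ENNReal.ofReal q ≤ P z {ω | (fun t => X t ω) ∈ stayOn V v (Iio t)} := fun z hz =>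
    le_measure_stayOn hX hL.continuous hL.one_le hφ hv1 (by linarith) htpos hq.2
      (by rw [htr, mul_div_cancel₀ _ hvφ.ne']) z hz
  have hstep : ∀ y, ℓ + 1 ≤ V y → ENNReal.ofReal (q * (K / Ψ R)) ≤
      P y {ω | (fun t => X t ω) ∈ reachStay V R ℓ v t} := fun y hy => by
    have := hX.isProbabilityMeasure y
    refine le_trans ?_ (hX.mul_measure_entryTime_lt_le hL.continuous y hstay)
    rw [ENNReal.ofReal_mul hq.1.le]
    gcongr
    exact ENNReal.ofReal_le_of_le_toReal (hexit R hRv y hy)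
  have hfinal := hX.mul_le_measure_inter x δ hAm
    (measurableSet_reachStay hL.continuous.measurable R ℓ v t) (fun ω hω => hstep (X δ ω) hω)
  have hsub : A ∩ {ω | (fun u => X (δ + u) ω) ∈ reachStay V R ℓ v t} ⊆
      {ω | ENNReal.ofReal r ≤ additiveFunctional X (h ∘ V) (hitAfter X D δ ω) ω} := by
    rintro ω ⟨-, hω⟩
    change ENNReal.ofReal r ≤ _
    rw [← hthr]
    exact le_additiveFunctional_of_mem_reachStay (hX.rightContinuous hL.continuous ω) hDm hmℓ
      (by linarith) hv1 hm hω
  have hreal := ENNReal.toReal_mono (measure_ne_top _ _) (hfinal.trans (measure_mono hsub))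
  rw [ENNReal.toReal_mul, ENNReal.toReal_ofReal (by have := hq.1; positivity)] at hreal
  calc q * K * (P x).real A / Ψ R = q * (K / Ψ R) * (P x).real A := by ring
    _ ≤ _ := hreal

end LDrift

theorem theorem2p4 {E Ω : Type*} [MetricSpace E] [LocallyCompactSpace E]
    [TopologicalSpace.SeparableSpace E] [MeasurableSpace E] [BorelSpace E]
    [mΩ : MeasurableSpace Ω] (F : Filtration ℝ≥0 mΩ) (X : ℝ≥0 → Ω → E) (P : E → Measure Ω)
    (π : Measure E) (hX : LDrift.IsStrongMarkov F X P) (hπ : LDrift.IsErgodicHarris X P π)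
    (V : E → ℝ) (φ Ψ : ℝ → ℝ) (hL : LDrift.LCondition F X P V φ Ψ)
    (D : Set E) (hD : MeasurableSet D) (m : ℝ) (hm : 1 < m) (hDm : D ⊆ {x | V x ≤ m})
    (q : ℝ) (hq : q ∈ Ioo (0 : ℝ) 1) (ε : ℝ) (hε : ε = (1 - q) / 2) :
    (∀ h : ℝ → ℝ, (∀ v, 1 ≤ v → 1 ≤ h v) → MonotoneOn h (Ici 1) → ContinuousOn h (Ici 1) →
      (StrictMonoOn (LDrift.growth φ ε h) (Ici 1) ∧ ContinuousOn (LDrift.growth φ ε h) (Ici 1) ∧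
        BijOn (LDrift.growth φ ε h) (Ici 1) (Ici (LDrift.growth φ ε h 1))) ∧
      ∀ x : E, ∃ (C r₀ : ℝ) (δ : ℝ≥0), 0 < C ∧ 0 < r₀ ∧ 0 < δ ∧ ∀ r, r₀ < r →
        C / Ψ (2 * LDrift.growthInv φ ε h r / (1 - q)) ≤
          (P x).real {ω | ENNReal.ofReal r ≤
            LDrift.additiveFunctional X (h ∘ V) (LDrift.hitAfter X D δ ω) ω}) ∧
    (∀ x : E, ∃ (C t₀ : ℝ) (δ : ℝ≥0), 0 < C ∧ 0 < t₀ ∧ 0 < δ ∧ ∀ t, t₀ < t →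
      C / Ψ (2 * LDrift.growthInv φ ε (fun _ => 1) t / (1 - q)) ≤
        (P x).real {ω | ENNReal.ofReal t ≤ LDrift.hitAfter X D δ ω}) := by
  subst hε
  refine ⟨fun h h1 hmono hc => ⟨?_, fun x =>
    LDrift.exists_le_measureReal_additiveFunctional hX hL hDm hq h1 hmono hc x⟩, fun x => ?_⟩
  · obtain ⟨ℓ₀, -, hφ, -⟩ := hL.drift
    have hε : 0 < (1 - q) / 2 := by linarith [hq.2]
    exact ⟨LDrift.strictMonoOn_growth hφ hε h1 hmono, LDrift.continuousOn_growth hφ hc,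
      LDrift.bijOn_growth hφ hε h1 hmono hc⟩
  · obtain ⟨C, t₀, δ, hC, ht₀, hδ, hbound⟩ :=
      LDrift.exists_le_measureReal_additiveFunctional hX hL hDm hq (h := fun _ => 1)
        (fun _ _ => le_rfl) monotoneOn_const continuousOn_const x
    have := hX.isProbabilityMeasure x
    refine ⟨C, t₀, δ, hC, ht₀, hδ, fun t ht => (hbound t ht).trans (measureReal_mono ?_)⟩
    intro ω hω
    exact le_trans hω (LDrift.additiveFunctional_one_le X _ ω)
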